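/- **Conventions.** A hypercomplex manifold $(M,H)$ is a smooth $4n$-manifold with a triple $H=(J_1,J_2,J_3)$ of integrable almost complex structures with $J_s^2=-\mathrm{id}$ and $J_1J_2=-J_2J_1=J_3$. Its Obata connection $\nabla^{ob}$ is the unique torsion-free connection with $\nabla^{ob}J_s=0$, $s=1,2,3$. A Riemannian metric $g$ is hyperhermitian if $g(J_s\cdot,J_s\cdot)=g$ for $s=1,2,3$. Given a hyperhermitian metric $g$ (one always exists), let $R^{ob}(X,Y)Z=\nabla^{ob}_X\nabla^{ob}_YZ-\nabla^{ob}_Y\nabla^{ob}_XZ-\nabla^{ob}_{[X,Y]}Z$, $R^{ob}(X,Y,Z,U)=g(R^{ob}(X,Y)Z,U)$ and, for a $g$-orthonormal basis $e_1,\dots,e_{4n}$ of the tangent space, $$Ric^{ob}(X,Y)=\sum_{a}R^{ob}(e_a,X,Y,e_a),\quad \rho^{ob}(X,Y)=\sum_{a}R^{ob}(X,Y,e_a,e_a),\quad \rho^{ob}_s(X,Y)=\tfrac12\sum_{a}R^{ob}(X,Y,e_a,J_se_a),$$ $$Scal^{ob}=\sum_{a}Ric^{ob}(e_a,e_a),\qquad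 Scal^{ob}_s=\sum_{a}Ric^{ob}(J_se_a,e_a).$$ $(M,g,H,\nabla)$ is an HKT manifold if $(M,H)$ is hypercomplex, $g$ is hyperhermitian, and $\nabla$ is a linear connection with $\nabla g=0$, $\nabla J_s=0$ $(s=1,2,3)$ whose torsion $T(X,Y,Z)=g(\nabla_XY-\nabla_YX-[X,Y],Z)$ is totally skew-symmetric. Its Lee form is $\theta(X)=-\frac12\sum_{a}T(J_tX,e_a,J_te_a)$, where $t\in\{1,2,3\}$ is arbitrary. For a one-form, $d\theta(X,Y)=X\theta(Y)-Y\theta(X)-\theta([X,Y])$. **Proposition.** On a hypercomplex manifold $(M,H)$, for $s=1,2,3$ and all $X,Y$, $$Ric^{ob}(J_sX,J_sY)+Ric^{ob}(Y,X)=2\rho^{ob}_s(J_sX,Y),\qquad Ric^{ob}(X,Y)-Ric^{ob}(Y,X)=-\rho^{ob}(X,Y).$$ On an HKT manifold $(M,g,H,\nabla)$, with the traces above taken with respect to $g$: a) $d\theta(J_sX,J_sY)=d\theta(X,Y)$ for $s=1,2,3$; b) $Ric^{ob}$ is skew-symmetric, and $$Ric^{ob}(X,Y)=d\theta(X,Y),\qquad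 \rho^{ob}=-2\,d\theta,\qquad \rho^{ob}_s=0,\quad s=1,2,3;$$ in particular $Ric^{ob}(J_sX,J_sY)=Ric^{ob}(X,Y)$ for $s=1,2,3$; c) $Scal^{ob}=Scal^{ob}_s=0$, $s=1,2,3$. -/

import Mathlib

open Bundle VectorField
open scoped Manifold ContDiff

noncomputable section HypercomplexDefinitions

variable {n : ℕ} {M : Type*} [TopologicalSpace M]
  [ChartedSpace (EuclideanSpace ℝ (Fin (4 * n))) M] [IsManifold (𝓡 (4 * n)) ∞ M]

/-- The vector field `X` is smooth. -/
abbrev IsSmoothField (X : ∀ x : M, TangentSpace (𝓡 (4 * n)) x) : Prop :=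
  ContMDiff (𝓡 (4 * n)) (𝓡 (4 * n)).tangent ∞
    (fun y => (⟨y, X y⟩ : TangentBundle (𝓡 (4 * n)) M))

/-- The vector field `X` is differentiable at the point `x`. -/
abbrev IsDifferentiableFieldAt (X : ∀ x : M, TangentSpace (𝓡 (4 * n)) x) (x : M) : Prop :=
  MDifferentiableAt (𝓡 (4 * n)) (𝓡 (4 * n)).tangent
    (fun y => (⟨y, X y⟩ : TangentBundle (𝓡 (4 * n)) M)) x

/-- A hypercomplex structure on a `4n`-dimensional smooth manifold: a triple of smooth almost
complex structures `J 0, J 1, J 2` (written `J₁, J₂, J₃` on paper) satisfying the quaternionic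
identities, each of which is integrable, i.e. has vanishing Nijenhuis tensor
`N(X, Y) = [JX, JY] - J[JX, Y] - J[X, JY] - [X, Y]`. -/
structure HypercomplexStructure (n : ℕ) (M : Type*) [TopologicalSpace M]
    [ChartedSpace (EuclideanSpace ℝ (Fin (4 * n))) M] [IsManifold (𝓡 (4 * n)) ∞ M] where
  /-- The three almost complex structures. -/
  J : Fin 3 → ∀ x : M, TangentSpace (𝓡 (4 * n)) x →L[ℝ] TangentSpace (𝓡 (4 * n)) x
  smooth : ∀ s, ContMDiff (𝓡 (4 * n))
    ((𝓡 (4 * n)).prod 𝓘(ℝ, EuclideanSpace ℝ (Fin (4 * n)) →L[ℝ] EuclideanSpace ℝ (Fin (4 * n)))) ∞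
    (fun x => TotalSpace.mk' (EuclideanSpace ℝ (Fin (4 * n)) →L[ℝ] EuclideanSpace ℝ (Fin (4 * n)))
      (E := fun x : M => TangentSpace (𝓡 (4 * n)) x →L[ℝ] TangentSpace (𝓡 (4 * n)) x) x (J s x))
  sq : ∀ s x v, J s x (J s x v) = -v
  mul_01 : ∀ x v, J 0 x (J 1 x v) = J 2 x v
  mul_10 : ∀ x v, J 1 x (J 0 x v) = -J 2 x v
  integrable : ∀ s (X Y : ∀ x : M, TangentSpace (𝓡 (4 * n)) x),
    IsSmoothField X → IsSmoothField Y → ∀ x,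
      mlieBracket (𝓡 (4 * n)) (fun y => J s y (X y)) (fun y => J s y (Y y)) x
        - J s x (mlieBracket (𝓡 (4 * n)) (fun y => J s y (X y)) Y x)
        - J s x (mlieBracket (𝓡 (4 * n)) X (fun y => J s y (Y y)) x)
        - mlieBracket (𝓡 (4 * n)) X Y x = 0

/-- Smooth Riemannian metrics on `M`. -/
abbrev TangentMetric (n : ℕ) (M : Type*) [TopologicalSpace M]
    [ChartedSpace (EuclideanSpace ℝ (Fin (4 * n))) M] [IsManifold (𝓡 (4 * n)) ∞ M] :=
  ContMDiffRiemannianMetric (𝓡 (4 * n)) ∞ (EuclideanSpace ℝ (Fin (4 * n)))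
    (fun x : M => TangentSpace (𝓡 (4 * n)) x)

/-- Linear connections on `M`; `D Y x v` is `(∇_v Y)(x)`. -/
abbrev LinearConnection (n : ℕ) (M : Type*) [TopologicalSpace M]
    [ChartedSpace (EuclideanSpace ℝ (Fin (4 * n))) M] [IsManifold (𝓡 (4 * n)) ∞ M] :=
  CovariantDerivative (𝓡 (4 * n)) (EuclideanSpace ℝ (Fin (4 * n)))
    (fun x : M => TangentSpace (𝓡 (4 * n)) x)

/-- The metric `g` is hyperhermitian: `g(J_s X, J_s Y) = g(X, Y)` for `s = 1, 2, 3`. -/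
def IsHyperhermitian (H : HypercomplexStructure n M) (g : TangentMetric n M) : Prop :=
  ∀ s x v w, g.inner x (H.J s x v) (H.J s x w) = g.inner x v w

/-- `∇ J_s = 0` for `s = 1, 2, 3`, i.e. `∇_v (J_s Y) = J_s (∇_v Y)`. -/
def PreservesHypercomplex (H : HypercomplexStructure n M) (D : LinearConnection n M) : Prop :=
  ∀ s (Y : ∀ x : M, TangentSpace (𝓡 (4 * n)) x) (x : M), IsDifferentiableFieldAt Y x →
    ∀ v, D (fun y => H.J s y (Y y)) x v = H.J s x (D Y x v)

/-- `∇ g = 0`, i.e. `v(g(Y, Z)) = g(∇_v Y, Z) + g(Y, ∇_v Z)`. -/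
def PreservesMetric (g : TangentMetric n M) (D : LinearConnection n M) : Prop :=
  ∀ (Y Z : ∀ x : M, TangentSpace (𝓡 (4 * n)) x) (x : M), IsDifferentiableFieldAt Y x → IsDifferentiableFieldAt Z x →
    ∀ v, mvfderiv (𝓡 (4 * n)) (fun y => g.inner y (Y y) (Z y)) x v
      = g.inner x (D Y x v) (Z x) + g.inner x (Y x) (D Z x v)

/-- The Obata connection of a hypercomplex manifold: the (unique) smooth linear connection with
`∇ J₁ = ∇ J₂ = ∇ J₃ = 0` and vanishing torsion. -/
structure IsObataConnection (H : HypercomplexStructure n M) (D : LinearConnection n M) : Prop where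
  smooth : CovariantDerivative.ContMDiffCovariantDerivative D ∞
  preserves : PreservesHypercomplex H D
  torsion_eq_zero : ∀ x, D.torsion x = 0

/-- The torsion of type `(0,3)`: `T(X, Y, Z) = g(T(X, Y), Z)`, where
`T(X, Y) = ∇_X Y - ∇_Y X - [X, Y]`. -/
def torsionThree (g : TangentMetric n M) (D : LinearConnection n M) (x : M)
    (u v w : TangentSpace (𝓡 (4 * n)) x) : ℝ :=
  g.inner x (D.torsion x u v) w

/-- `(M, g, H, ∇)` is hyperkähler with torsion: the metric `g` is hyperhermitian and `∇` is a smooth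
linear connection preserving `g` and `J₁, J₂, J₃` whose torsion is totally skew-symmetric.
(Skew-symmetry of `T(X, Y, Z)` in the first two arguments is automatic.) -/
structure IsHKT (H : HypercomplexStructure n M) (g : TangentMetric n M)
    (D : LinearConnection n M) : Prop where
  hyperhermitian : IsHyperhermitian H g
  smooth : CovariantDerivative.ContMDiffCovariantDerivative D ∞
  preserves : PreservesHypercomplex H D
  preserves_metric : PreservesMetric g D
  skew_torsion : ∀ x u v w, torsionThree g D x u v w = -torsionThree g D x u w v

/-- A `g`-orthonormal basis `e_1, …, e_{4n}` of `T_x M`. Every sum over it below is the trace of a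
bilinear form with respect to `g`, hence does not depend on which orthonormal basis is used. -/
def orthoFrame (g : TangentMetric n M) (x : M) :
    Module.Basis (Fin (4 * n)) ℝ (TangentSpace (𝓡 (4 * n)) x) :=
  letI : RiemannianBundle (fun x : M => TangentSpace (𝓡 (4 * n)) x) := ⟨g.toRiemannianMetric⟩
  haveI : FiniteDimensional ℝ (TangentSpace (𝓡 (4 * n)) x) :=
    inferInstanceAs (FiniteDimensional ℝ (EuclideanSpace ℝ (Fin (4 * n))))
  ((stdOrthonormalBasis ℝ (TangentSpace (𝓡 (4 * n)) x)).reindex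
    (finCongr (finrank_euclideanSpace_fin (𝕜 := ℝ) (n := 4 * n)))).toBasis

/-- The basis `orthoFrame g x` is indeed orthonormal. -/
theorem orthoFrame_inner (g : TangentMetric n M) (x : M) (a b : Fin (4 * n)) :
    g.inner x (orthoFrame g x a) (orthoFrame g x b) = if a = b then 1 else 0 := by
  let _ : RiemannianBundle (fun x : M => TangentSpace (𝓡 (4 * n)) x) := ⟨g.toRiemannianMetric⟩
  have : FiniteDimensional ℝ (TangentSpace (𝓡 (4 * n)) x) :=
    inferInstanceAs (FiniteDimensional ℝ (EuclideanSpace ℝ (Fin (4 * n))))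
  have h := ((stdOrthonormalBasis ℝ (TangentSpace (𝓡 (4 * n)) x)).reindex
    (finCongr (finrank_euclideanSpace_fin (𝕜 := ℝ) (n := 4 * n)))).inner_eq_ite a b
  rw [← h]
  simp [orthoFrame]
  rfl

/-- The Lee form of an HKT manifold computed from the complex structure `J_t`:
`θ(X) = -1/2 ∑ₐ T(J_t X, e_a, J_t e_a)`, with `T` the torsion three-form of the HKT connection. -/
def leeForm (H : HypercomplexStructure n M) (g : TangentMetric n M) (D : LinearConnection n M)
    (t : Fin 3) (x : M) (v : TangentSpace (𝓡 (4 * n)) x) : ℝ :=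
  -(1 / 2) * ∑ a, torsionThree g D x (H.J t x v) (orthoFrame g x a) (H.J t x (orthoFrame g x a))

/-- The exterior derivative of a one-form, `dα(X, Y) = X(α(Y)) - Y(α(X)) - α([X, Y])`. The tangent
vectors `u, v` at `x` are extended to the vector fields that are constant in the preferred chart at
`x` (the result does not depend on the choice of the extensions). -/
def extDerivOneForm (α : ∀ x : M, TangentSpace (𝓡 (4 * n)) x → ℝ) (x : M)
    (u v : TangentSpace (𝓡 (4 * n)) x) : ℝ :=
  let X := FiberBundle.extend (EuclideanSpace ℝ (Fin (4 * n))) u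
  let Y := FiberBundle.extend (EuclideanSpace ℝ (Fin (4 * n))) v
  mvfderiv (𝓡 (4 * n)) (fun y => α y (Y y)) x u - mvfderiv (𝓡 (4 * n)) (fun y => α y (X y)) x v
    - α x (mlieBracket (𝓡 (4 * n)) X Y x)

/-- The curvature `R(X, Y)Z = ∇_X ∇_Y Z - ∇_Y ∇_X Z - ∇_{[X, Y]} Z` of a linear connection. The
tangent vectors `u, v, w` at `x` are extended to the vector fields that are constant in the
preferred chart at `x` (the result does not depend on the choice of the extensions). -/
def curvature (D : LinearConnection n M) (x : M) (u v w : TangentSpace (𝓡 (4 * n)) x) :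
    TangentSpace (𝓡 (4 * n)) x :=
  let X := FiberBundle.extend (EuclideanSpace ℝ (Fin (4 * n))) u
  let Y := FiberBundle.extend (EuclideanSpace ℝ (Fin (4 * n))) v
  let Z := FiberBundle.extend (EuclideanSpace ℝ (Fin (4 * n))) w
  D (fun y => D Z y (Y y)) x u - D (fun y => D Z y (X y)) x v
    - D Z x (mlieBracket (𝓡 (4 * n)) X Y x)

/-- The curvature tensor of type `(0,4)`: `R(X, Y, Z, U) = g(R(X, Y)Z, U)`. -/
def curvatureFour (g : TangentMetric n M) (D : LinearConnection n M) (x : M)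
    (u v w z : TangentSpace (𝓡 (4 * n)) x) : ℝ :=
  g.inner x (curvature D x u v w) z

/-- The Ricci tensor `Ric(X, Y) = ∑ₐ R(e_a, X, Y, e_a)`. -/
def ricciTensor (g : TangentMetric n M) (D : LinearConnection n M) (x : M)
    (u v : TangentSpace (𝓡 (4 * n)) x) : ℝ :=
  ∑ a, curvatureFour g D x (orthoFrame g x a) u v (orthoFrame g x a)

/-- The Ricci-type form `ρ(X, Y) = ∑ₐ R(X, Y, e_a, e_a)`. -/
def ricciForm (g : TangentMetric n M) (D : LinearConnection n M) (x : M)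
    (u v : TangentSpace (𝓡 (4 * n)) x) : ℝ :=
  ∑ a, curvatureFour g D x u v (orthoFrame g x a) (orthoFrame g x a)

/-- The Ricci-type form `ρ_s(X, Y) = 1/2 ∑ₐ R(X, Y, e_a, J_s e_a)`. -/
def ricciFormJ (H : HypercomplexStructure n M) (g : TangentMetric n M) (D : LinearConnection n M)
    (s : Fin 3) (x : M) (u v : TangentSpace (𝓡 (4 * n)) x) : ℝ :=
  (1 / 2) * ∑ a, curvatureFour g D x u v (orthoFrame g x a) (H.J s x (orthoFrame g x a))

/-- The scalar curvature `Scal = ∑ₐ Ric(e_a, e_a)`. -/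
def scalarCurvature (g : TangentMetric n M) (D : LinearConnection n M) (x : M) : ℝ :=
  ∑ a, ricciTensor g D x (orthoFrame g x a) (orthoFrame g x a)

/-- The scalar curvature `Scal_s = ∑ₐ Ric(J_s e_a, e_a)`. -/
def scalarCurvatureJ (H : HypercomplexStructure n M) (g : TangentMetric n M)
    (D : LinearConnection n M) (s : Fin 3) (x : M) : ℝ :=
  ∑ a, ricciTensor g D x (H.J s x (orthoFrame g x a)) (orthoFrame g x a)

end HypercomplexDefinitions

/-! The curvature endomorphism R(X,Y) of the Obata connection commutes with the quaternions. For
each J_s some J_t anticommutes with it, and conjugation by J_t turns J_s R(X,Y) into its negative,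
so its trace vanishes: ρ_s = 0. The two identities for Ric are traces of the first Bianchi identity,
against e_a and against J_s e_a. With ρ_s = 0 the second reads Ric(J_s X, J_s Y) = -Ric(Y, X). Since
J_3 = J_1 J_2, applying this for s = 1 and s = 2 must agree with s = 3, and this forces Ric to be
skew. Hence Ric = -ρ/2, each J_s preserves Ric, and both scalar curvatures vanish.

It remains to identify ρ = tr R. In a local frame tr R is the exterior derivative of the trace of
the connection form. For the metric HKT connection this trace curvature is zero, so ρ of the Obata
connection is the exterior derivative of v ↦ tr A_v, where A_v = ∇^ob_v - ∇_v is a globally defined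
tensor. Skew torsion and the quaternionic linearity of A_v give tr A_v = -2θ(v)
(`neg_two_mul_leeForm`), whence ρ = -2dθ (`ricciForm_eq_extDerivOneForm_leeForm`) and Ric = dθ. -/

open scoped Topology

/-! ### Locally smooth functions and vector fields. -/

section SmoothGerms

set_option linter.unusedSectionVars false

variable {n : ℕ} {M : Type*} [TopologicalSpace M]
  [ChartedSpace (EuclideanSpace ℝ (Fin (4 * n))) M]

/-- The function `f` is smooth in a neighbourhood of `x`. -/
def FunctionSmoothNear (f : M → ℝ) (x : M) : Prop :=
  ∀ᶠ y in 𝓝 x, ContMDiffAt (𝓡 (4 * n)) 𝓘(ℝ, ℝ) ∞ f y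

/-- The derivative of the function `f` along the vector field `X`. -/
noncomputable def dirDeriv (X : ∀ x : M, TangentSpace (𝓡 (4 * n)) x) (f : M → ℝ) (x : M) : ℝ :=
  mvfderiv (𝓡 (4 * n)) f x (X x)

variable [IsManifold (𝓡 (4 * n)) ∞ M]

/-- The vector field `X` is smooth in a neighbourhood of `x`. -/
def FieldSmoothNear (X : ∀ x : M, TangentSpace (𝓡 (4 * n)) x) (x : M) : Prop :=
  ∀ᶠ y in 𝓝 x, ContMDiffAt (𝓡 (4 * n)) (𝓡 (4 * n)).tangent ∞
    (fun y => (⟨y, X y⟩ : TangentBundle (𝓡 (4 * n)) M)) y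

variable {x : M} {X Y Z : ∀ x : M, TangentSpace (𝓡 (4 * n)) x} {f h : M → ℝ}

theorem FieldSmoothNear.eventually (hX : FieldSmoothNear X x) :
    ∀ᶠ y in 𝓝 x, FieldSmoothNear X y :=
  eventually_eventually_nhds.2 hX

theorem FunctionSmoothNear.eventually (hf : FunctionSmoothNear (n := n) f x) :
    ∀ᶠ y in 𝓝 x, FunctionSmoothNear (n := n) f y :=
  eventually_eventually_nhds.2 hf

theorem FieldSmoothNear.contMDiffAt (hX : FieldSmoothNear X x) :
    ContMDiffAt (𝓡 (4 * n)) (𝓡 (4 * n)).tangent ∞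
      (fun y => (⟨y, X y⟩ : TangentBundle (𝓡 (4 * n)) M)) x :=
  hX.self_of_nhds

theorem FieldSmoothNear.mdifferentiableAt (hX : FieldSmoothNear X x) :
    IsDifferentiableFieldAt X x :=
  hX.contMDiffAt.mdifferentiableAt (by simp)

theorem FunctionSmoothNear.mdifferentiableAt (hf : FunctionSmoothNear (n := n) f x) :
    MDifferentiableAt (𝓡 (4 * n)) 𝓘(ℝ, ℝ) f x :=
  hf.self_of_nhds.mdifferentiableAt (by simp)

theorem FieldSmoothNear.congr (hX : FieldSmoothNear X x) (h : ∀ᶠ y in 𝓝 x, Y y = X y) :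
    FieldSmoothNear Y x := by
  filter_upwards [hX, eventually_eventually_nhds.2 h] with y hy hy'
  refine hy.congr_of_eventuallyEq ?_
  filter_upwards [hy'] with z hz
  simp [hz]

theorem FunctionSmoothNear.congr (hf : FunctionSmoothNear (n := n) f x) (hh : h =ᶠ[𝓝 x] f) :
    FunctionSmoothNear (n := n) h x := by
  filter_upwards [hf, eventually_eventually_nhds.2 hh] with y hy hy'
  exact hy.congr_of_eventuallyEq hy'

theorem FieldSmoothNear.add (hX : FieldSmoothNear X x) (hY : FieldSmoothNear Y x) :
    FieldSmoothNear (X + Y) x := by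
  filter_upwards [hX, hY] with y h1 h2
  exact h1.add_section h2

theorem FieldSmoothNear.neg (hX : FieldSmoothNear X x) : FieldSmoothNear (-X) x := by
  filter_upwards [hX] with y h1
  exact h1.neg_section

theorem FieldSmoothNear.smul (hf : FunctionSmoothNear (n := n) f x) (hX : FieldSmoothNear X x) :
    FieldSmoothNear (f • X) x := by
  filter_upwards [hf, hX] with y h1 h2
  exact h1.smul_section h2

theorem FunctionSmoothNear.sub (hf : FunctionSmoothNear (n := n) f x)
    (hh : FunctionSmoothNear (n := n) h x) :
    FunctionSmoothNear (n := n) (fun y => f y - h y) x := by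
  filter_upwards [hf, hh] with y h1 h2
  exact h1.sub h2

theorem FieldSmoothNear.sum {ι : Type*} {s : Finset ι}
    {X : ι → ∀ x : M, TangentSpace (𝓡 (4 * n)) x} (hX : ∀ i ∈ s, FieldSmoothNear (X i) x) :
    FieldSmoothNear (fun y => ∑ i ∈ s, X i y) x := by
  have := (Filter.eventually_all_finset s).2 hX
  filter_upwards [this] with y h1
  exact ContMDiffAt.sum_section h1

theorem FunctionSmoothNear.sum {ι : Type*} {s : Finset ι} {f : ι → M → ℝ}
    (hf : ∀ i ∈ s, FunctionSmoothNear (n := n) (f i) x) :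
    FunctionSmoothNear (n := n) (fun y => ∑ i ∈ s, f i y) x := by
  have := (Filter.eventually_all_finset s).2 hf
  filter_upwards [this] with y h1
  exact ContMDiffAt.sum h1

theorem isManifold_minSmoothness_two : IsManifold (𝓡 (4 * n)) (minSmoothness ℝ 2) M := by
  rw [minSmoothness_of_isRCLikeNormedField]
  infer_instance

theorem isManifold_minSmoothness_three : IsManifold (𝓡 (4 * n)) (minSmoothness ℝ 3) M := by
  rw [minSmoothness_of_isRCLikeNormedField]
  infer_instance

theorem FieldSmoothNear.mlieBracket (hX : FieldSmoothNear X x) (hY : FieldSmoothNear Y x) :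
    FieldSmoothNear (mlieBracket (𝓡 (4 * n)) X Y) x := by
  filter_upwards [hX, hY] with y h1 h2
  have : IsManifold (𝓡 (4 * n)) ((⊤ : ℕ∞) + 1) M := by simpa
  have := isManifold_minSmoothness_two (n := n) (M := M)
  exact ContMDiffAt.mlieBracket_vectorField (n := ⊤) (m := ⊤) h1 h2 (by simp)

theorem fieldSmoothNear_extend (v : TangentSpace (𝓡 (4 * n)) x) :
    FieldSmoothNear (FiberBundle.extend (EuclideanSpace ℝ (Fin (4 * n))) v) x := by
  obtain ⟨s, hs, hsv⟩ := FiberBundle.exists_contMDiffOn_extend (k := ∞) (𝓡 (4 * n))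
    (EuclideanSpace ℝ (Fin (4 * n))) v
  filter_upwards [eventually_mem_nhds_iff.2 hs] with y hy
  exact hsv.contMDiffAt hy

theorem FieldSmoothNear.clm_apply
    {A : ∀ x : M, TangentSpace (𝓡 (4 * n)) x →L[ℝ] TangentSpace (𝓡 (4 * n)) x}
    (hA : ∀ᶠ y in 𝓝 x, ContMDiffAt (𝓡 (4 * n)) ((𝓡 (4 * n)).prod
      𝓘(ℝ, EuclideanSpace ℝ (Fin (4 * n)) →L[ℝ] EuclideanSpace ℝ (Fin (4 * n)))) ∞
      (fun x => TotalSpace.mk' (EuclideanSpace ℝ (Fin (4 * n)) →L[ℝ] EuclideanSpace ℝ (Fin (4 * n)))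
      (E := fun x : M => TangentSpace (𝓡 (4 * n)) x →L[ℝ] TangentSpace (𝓡 (4 * n)) x) x (A x)) y)
    (hX : FieldSmoothNear X x) : FieldSmoothNear (fun y => A y (X y)) x := by
  filter_upwards [hA, hX] with y h1 h2
  exact h1.clm_bundle_apply h2

theorem FieldSmoothNear.complexStructure (H : HypercomplexStructure n M) (s : Fin 3)
    (hX : FieldSmoothNear X x) : FieldSmoothNear (fun y => H.J s y (X y)) x :=
  hX.clm_apply (.of_forall (H.smooth s))

theorem FieldSmoothNear.inner (g : TangentMetric n M) (hX : FieldSmoothNear X x)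
    (hY : FieldSmoothNear Y x) :
    FunctionSmoothNear (n := n) (fun y => g.inner y (X y) (Y y)) x := by
  filter_upwards [hX, hY] with y h1 h2
  let _ : RiemannianBundle (fun x : M => TangentSpace (𝓡 (4 * n)) x) := ⟨g.toRiemannianMetric⟩
  exact ContMDiffAt.inner_bundle (IB := 𝓡 (4 * n)) h1 h2

theorem exists_bump_mul [T2Space M] {s : Set M} (hs : s ∈ 𝓝 x) :
    ∃ ψ : M → ℝ, ContMDiff (𝓡 (4 * n)) 𝓘(ℝ, ℝ) ∞ ψ ∧ tsupport ψ ⊆ s ∧ ψ =ᶠ[𝓝 x] 1 := by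
  obtain ⟨ψ, -, hψ⟩ := (SmoothBumpFunction.nhds_basis_tsupport (I := 𝓡 (4 * n)) x).mem_iff.1 hs
  exact ⟨ψ, ψ.contMDiff, hψ, ψ.eventuallyEq_one⟩

/-- Multiply by a bump function. The chart-constant extensions of tangent vectors are smooth only
locally, while smoothness of a connection is applied to globally smooth fields. -/
theorem FieldSmoothNear.exists_global [T2Space M] (hX : FieldSmoothNear X x) :
    ∃ Y : ∀ x : M, TangentSpace (𝓡 (4 * n)) x, IsSmoothField Y ∧ ∀ᶠ y in 𝓝 x, Y y = X y := by
  obtain ⟨s, hs, hso, hxs⟩ := eventually_nhds_iff.1 hX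
  obtain ⟨ψ, hψ, hψs, hψ1⟩ := exists_bump_mul (n := n) (hso.mem_nhds hxs)
  refine ⟨ψ • X, ContMDiffOn.smul_section_of_tsupport hψ.contMDiffOn hso hψs
    (fun y hy => (hs y hy).contMDiffWithinAt), ?_⟩
  filter_upwards [hψ1] with y hy
  simp [hy]

theorem FunctionSmoothNear.exists_global [T2Space M] (hf : FunctionSmoothNear (n := n) f x) :
    ∃ h : M → ℝ, ContMDiff (𝓡 (4 * n)) 𝓘(ℝ, ℝ) ∞ h ∧ h =ᶠ[𝓝 x] f := by
  obtain ⟨s, hs, hso, hxs⟩ := eventually_nhds_iff.1 hf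
  obtain ⟨ψ, hψ, hψs, hψ1⟩ := exists_bump_mul (n := n) (hso.mem_nhds hxs)
  refine ⟨ψ * f, contMDiff_of_tsupport fun y hy => ?_, ?_⟩
  · exact hψ.contMDiffAt.mul (hs y (hψs (tsupport_mul_subset_left hy)))
  · filter_upwards [hψ1] with y hy
    simp [hy]

theorem dirDeriv_congr (hfh : f =ᶠ[𝓝 x] h) : dirDeriv X f x = dirDeriv X h x := by
  simp only [dirDeriv, mvfderiv]
  rw [hfh.mfderiv_eq]
  rfl

theorem FunctionSmoothNear.dirDeriv [T2Space M] (hf : FunctionSmoothNear (n := n) f x)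
    (hX : FieldSmoothNear X x) : FunctionSmoothNear (n := n) (dirDeriv X f) x := by
  obtain ⟨h, hh, hhf⟩ := hf.exists_global
  have key : FunctionSmoothNear (n := n) (_root_.dirDeriv X h) x := by
    filter_upwards [hX] with y hy
    -- The derivative of h along X is the fibre component of the tangent map of h composed with X.
    have h1 := (hh.contMDiff_tangentMap (m := ∞) (by simp)).contMDiffAt.comp y hy
    exact (contMDiff_snd_tangentBundle_modelSpace ℝ 𝓘(ℝ, ℝ)).contMDiffAt.comp y h1
  refine key.congr ?_
  filter_upwards [eventually_eventually_nhds.2 hhf] with y hy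
  exact (dirDeriv_congr hy).symm

theorem dirDeriv_add (hf : FunctionSmoothNear (n := n) f x)
    (hh : FunctionSmoothNear (n := n) h x) :
    dirDeriv X (fun y => f y + h y) x = dirDeriv X f x + dirDeriv X h x := by
  simp [dirDeriv, mvfderiv_fun_add hf.mdifferentiableAt hh.mdifferentiableAt]

theorem dirDeriv_sub (hf : FunctionSmoothNear (n := n) f x)
    (hh : FunctionSmoothNear (n := n) h x) :
    dirDeriv X (fun y => f y - h y) x = dirDeriv X f x - dirDeriv X h x := by
  simp [dirDeriv, mvfderiv_fun_sub hf.mdifferentiableAt hh.mdifferentiableAt]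

theorem dirDeriv_const_mul (c : ℝ) (hf : FunctionSmoothNear (n := n) f x) :
    dirDeriv X (fun y => c * f y) x = c * dirDeriv X f x := by
  have hc : MDifferentiableAt (𝓡 (4 * n)) 𝓘(ℝ, ℝ) (fun _ : M => c) x := mdifferentiableAt_const
  simp [dirDeriv, mvfderiv_fun_mul hc hf.mdifferentiableAt, mvfderiv_const]

theorem dirDeriv_sum {ι : Type*} {s : Finset ι} {f : ι → M → ℝ}
    (hf : ∀ i ∈ s, FunctionSmoothNear (n := n) (f i) x) :
    dirDeriv X (fun y => ∑ i ∈ s, f i y) x = ∑ i ∈ s, dirDeriv X (f i) x := by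
  classical
  induction s using Finset.induction_on with
  | empty => simp [dirDeriv, mvfderiv_const]
  | insert a s ha ih =>
    simp only [Finset.mem_insert, forall_eq_or_imp] at hf
    simp only [Finset.sum_insert ha]
    rw [dirDeriv_add hf.1 (.sum hf.2), ih hf.2]

end SmoothGerms

/-! ### Coordinate frames and Lie brackets. -/

section LocalFrames

set_option linter.unusedSectionVars false

variable {n : ℕ} {M : Type*} [TopologicalSpace M]
  [ChartedSpace (EuclideanSpace ℝ (Fin (4 * n))) M] [IsManifold (𝓡 (4 * n)) ∞ M]

/-- The coordinate frame of the tangent bundle in the preferred trivialization at `x`. -/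
noncomputable def frameAt (x : M) (i : Fin (4 * n)) (y : M) : TangentSpace (𝓡 (4 * n)) y :=
  (trivializationAt (EuclideanSpace ℝ (Fin (4 * n))) (TangentSpace (𝓡 (4 * n))) x).localFrame
    (EuclideanSpace.basisFun (Fin (4 * n)) ℝ).toBasis i y

/-- The coefficients of tangent vectors with respect to `frameAt x`. -/
noncomputable def frameCoeffAt (x : M) (i : Fin (4 * n)) (y : M) :
    TangentSpace (𝓡 (4 * n)) y →ₗ[ℝ] ℝ :=
  (trivializationAt (EuclideanSpace ℝ (Fin (4 * n)))
    (TangentSpace (𝓡 (4 * n))) x).localFrameCoeff (𝓡 (4 * n))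
      (EuclideanSpace.basisFun (Fin (4 * n)) ℝ).toBasis i y

theorem eventually_mem_baseSet (x : M) : ∀ᶠ y in 𝓝 x,
    y ∈ (trivializationAt (EuclideanSpace ℝ (Fin (4 * n)))
      (TangentSpace (𝓡 (4 * n))) x).baseSet :=
  (Trivialization.open_baseSet _).mem_nhds 
    (FiberBundle.mem_baseSet_trivializationAt (EuclideanSpace ℝ (Fin (4 * n)))
      (TangentSpace (𝓡 (4 * n))) x)

theorem fieldSmoothNear_frameAt (x : M) (i : Fin (4 * n)) : FieldSmoothNear (frameAt x i) x := by
  filter_upwards [eventually_mem_baseSet (n := n) x] with y hy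
  exact contMDiffAt_localFrame_of_mem ∞ _ _ i hy

variable {x : M} {X Y Z : ∀ x : M, TangentSpace (𝓡 (4 * n)) x} {f : M → ℝ}

theorem FieldSmoothNear.frameCoeffAt (hX : FieldSmoothNear X x) (i : Fin (4 * n)) :
    FunctionSmoothNear (n := n) (fun y => frameCoeffAt x i y (X y)) x := by
  filter_upwards [eventually_mem_baseSet (n := n) x, hX] with y hy h
  exact contMDiffAt_localFrameCoeff _ hy h i

theorem eventually_exists_basis_frameAt (x : M) : ∀ᶠ y in 𝓝 x,
    ∃ b : Module.Basis (Fin (4 * n)) ℝ (TangentSpace (𝓡 (4 * n)) y),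
      (∀ i, b i = frameAt x i y) ∧ ∀ i v, b.repr v i = frameCoeffAt x i y v := by
  filter_upwards [eventually_mem_baseSet (n := n) x] with y hy
  refine ⟨Trivialization.basisAt _ (EuclideanSpace.basisFun (Fin (4 * n)) ℝ).toBasis hy,
    fun i => ?_, fun i v => ?_⟩
  · exact (Trivialization.localFrame_apply_of_mem_baseSet _ _ hy).symm
  · have := Trivialization.localFrameCoeff_apply_of_mem_baseSet (I := 𝓡 (4 * n))
      (V := TangentSpace (𝓡 (4 * n)) (M := M)) _
      (EuclideanSpace.basisFun (Fin (4 * n)) ℝ).toBasis hy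
      (fun z => FiberBundle.extend (EuclideanSpace ℝ (Fin (4 * n))) v z) i
    simp only [FiberBundle.extend_apply_self] at this
    exact this.symm

theorem eventually_eq_sum_frameAt (x : M) : ∀ᶠ y in 𝓝 x, ∀ v : TangentSpace (𝓡 (4 * n)) y,
    v = ∑ i, frameCoeffAt x i y v • frameAt x i y := by
  filter_upwards [eventually_exists_basis_frameAt (n := n) x] with y ⟨b, hb, hb'⟩ v
  conv_lhs => rw [← b.sum_repr v]
  simp [hb, hb']

theorem eventually_trace_eq_sum_frameAt (x : M) : ∀ᶠ y in 𝓝 x,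
    ∀ A : TangentSpace (𝓡 (4 * n)) y →ₗ[ℝ] TangentSpace (𝓡 (4 * n)) y,
      LinearMap.trace ℝ _ A = ∑ i, frameCoeffAt x i y (A (frameAt x i y)) := by
  filter_upwards [eventually_exists_basis_frameAt (n := n) x] with y ⟨b, hb, hb'⟩ A
  rw [LinearMap.trace_eq_matrix_trace ℝ b, Matrix.trace]
  simp [LinearMap.toMatrix_apply, hb, hb']

theorem mlieBracket_congr_right (h : ∀ᶠ y in 𝓝 x, Y y = Z y) :
    mlieBracket (𝓡 (4 * n)) X Y x = mlieBracket (𝓡 (4 * n)) X Z x :=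
  Filter.EventuallyEq.mlieBracket_vectorField_eq (.rfl) h

theorem mlieBracket_smul_dirDeriv (hf : FunctionSmoothNear (n := n) f x)
    (hY : FieldSmoothNear Y x) :
    mlieBracket (𝓡 (4 * n)) X (f • Y) x
      = dirDeriv X f x • Y x + f x • mlieBracket (𝓡 (4 * n)) X Y x :=
  mlieBracket_smul_right hf.mdifferentiableAt hY.mdifferentiableAt

/-- Two applications of the Leibniz rule. The second derivative X(Yf) appears as a coefficient of Z,
from which the commutator formula for functions can be read off. -/
theorem mlieBracket_mlieBracket_smul [T2Space M] (hY : FieldSmoothNear Y x)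
    (hZ : FieldSmoothNear Z x) (hf : FunctionSmoothNear (n := n) f x) :
    mlieBracket (𝓡 (4 * n)) X (mlieBracket (𝓡 (4 * n)) Y (f • Z)) x
      = dirDeriv X (dirDeriv Y f) x • Z x + dirDeriv Y f x • mlieBracket (𝓡 (4 * n)) X Z x
        + (dirDeriv X f x • mlieBracket (𝓡 (4 * n)) Y Z x
        + f x • mlieBracket (𝓡 (4 * n)) X (mlieBracket (𝓡 (4 * n)) Y Z) x) := by
  have h1 : ∀ᶠ y in 𝓝 x, mlieBracket (𝓡 (4 * n)) Y (f • Z) y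
      = ((dirDeriv Y f) • Z + f • mlieBracket (𝓡 (4 * n)) Y Z) y := by
    filter_upwards [hf.eventually, hZ.eventually] with y h1 h2
    exact mlieBracket_smul_dirDeriv h1 h2
  rw [mlieBracket_congr_right h1, mlieBracket_add_right
    (FieldSmoothNear.smul (hf.dirDeriv hY) hZ).mdifferentiableAt
    (FieldSmoothNear.smul hf (hY.mlieBracket hZ)).mdifferentiableAt,
    mlieBracket_smul_dirDeriv (hf.dirDeriv hY) hZ, mlieBracket_smul_dirDeriv hf (hY.mlieBracket hZ)]

theorem mlieBracket_jacobi (hX : FieldSmoothNear X x) (hY : FieldSmoothNear Y x)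
    (hZ : FieldSmoothNear Z x) :
    mlieBracket (𝓡 (4 * n)) X (mlieBracket (𝓡 (4 * n)) Y Z) x
      = mlieBracket (𝓡 (4 * n)) (mlieBracket (𝓡 (4 * n)) X Y) Z x
        + mlieBracket (𝓡 (4 * n)) Y (mlieBracket (𝓡 (4 * n)) X Z) x := by
  have := isManifold_minSmoothness_three (n := n) (M := M)
  have h2 : minSmoothness ℝ 2 ≤ ∞ := by
    rw [minSmoothness_of_isRCLikeNormedField]
    exact ENat.LEInfty.out
  exact leibniz_identity_mlieBracket_apply (hX.contMDiffAt.of_le h2) (hY.contMDiffAt.of_le h2)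
    (hZ.contMDiffAt.of_le h2)

/-- Second derivatives of functions: `[X, Y] f = X (Y f) - Y (X f)`. -/
theorem dirDeriv_mlieBracket [T2Space M] (hX : FieldSmoothNear X x) (hY : FieldSmoothNear Y x)
    (hf : FunctionSmoothNear (n := n) f x) :
    dirDeriv (mlieBracket (𝓡 (4 * n)) X Y) f x
      = dirDeriv X (dirDeriv Y f) x - dirDeriv Y (dirDeriv X f) x := by
  obtain ⟨b, hb, -⟩ := (eventually_exists_basis_frameAt (n := n) x).self_of_nhds
  -- In dimension zero there is no frame field, but all tangent vectors vanish.
  rcases isEmpty_or_nonempty (Fin (4 * n)) with h0 | ⟨⟨i⟩⟩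
  · have hs : ∀ v : TangentSpace (𝓡 (4 * n)) x, v = 0 := fun v => by
      rw [← b.sum_repr v]
      simp
    simp [dirDeriv, hs (mlieBracket (𝓡 (4 * n)) X Y x), hs (X x), hs (Y x)]
  · have hZ := fieldSmoothNear_frameAt x i
    have hne : frameAt x i x ≠ 0 := hb i ▸ b.ne_zero i
    -- Expand the Jacobi identity for X, Y, fZ and subtract f times the one for X, Y, Z. The
    -- first-order terms cancel, leaving ([X,Y]f - X(Yf) + Y(Xf)) Z = 0 with Z nonzero at x.
    have h := mlieBracket_jacobi hX hY (hZ.smul hf)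
    rw [mlieBracket_mlieBracket_smul hY hZ hf, mlieBracket_mlieBracket_smul hX hZ hf,
      mlieBracket_smul_dirDeriv hf hZ, mlieBracket_jacobi hX hY hZ] at h
    have h' : (dirDeriv (mlieBracket (𝓡 (4 * n)) X Y) f x
      - (dirDeriv X (dirDeriv Y f) x - dirDeriv Y (dirDeriv X f) x)) • frameAt x i x = 0 := by
      rw [smul_add] at h
      linear_combination (norm := module) -h
    exact sub_eq_zero.1 ((smul_eq_zero.1 h').resolve_right hne)

end LocalFrames

/-! ### Local calculus of linear connections. -/

section Connections

set_option linter.unusedSectionVars false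

variable {n : ℕ} {M : Type*} [TopologicalSpace M] [T2Space M]
  [ChartedSpace (EuclideanSpace ℝ (Fin (4 * n))) M] [IsManifold (𝓡 (4 * n)) ∞ M]
  {D : LinearConnection n M}
  {x : M} {X Y Z W : ∀ x : M, TangentSpace (𝓡 (4 * n)) x} {f : M → ℝ}

theorem connection_congr (D : LinearConnection n M) (hY : FieldSmoothNear Y x)
    (h : ∀ᶠ y in 𝓝 x, Z y = Y y) : D Z x = D Y x :=
  (D.isCovariantDerivativeOn (s := Set.univ)).congr_of_eventuallyEq
    (hY.congr h).mdifferentiableAt hY.mdifferentiableAt Filter.univ_mem h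

theorem connection_add (D : LinearConnection n M) (hY : FieldSmoothNear Y x)
    (hZ : FieldSmoothNear Z x) (v : TangentSpace (𝓡 (4 * n)) x) :
    D (Y + Z) x v = D Y x v + D Z x v := by
  rw [(D.isCovariantDerivativeOn (s := Set.univ)).add hY.mdifferentiableAt hZ.mdifferentiableAt]
  rfl

theorem connection_smul (D : LinearConnection n M) (hf : FunctionSmoothNear (n := n) f x)
    (hY : FieldSmoothNear Y x) (v : TangentSpace (𝓡 (4 * n)) x) :
    D (f • Y) x v = f x • D Y x v + mvfderiv (𝓡 (4 * n)) f x v • Y x := by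
  rw [(D.isCovariantDerivativeOn (s := Set.univ)).leibniz hY.mdifferentiableAt hf.mdifferentiableAt]
  rfl

theorem connection_neg (D : LinearConnection n M) (hY : FieldSmoothNear Y x)
    (v : TangentSpace (𝓡 (4 * n)) x) : D (-Y) x v = -D Y x v := by
  have h := (D.isCovariantDerivativeOn (s := Set.univ)).smul_const (-1) hY.mdifferentiableAt
  rw [neg_one_smul, neg_one_smul] at h
  rw [h]
  rfl

theorem connection_sub (D : LinearConnection n M) (hY : FieldSmoothNear Y x)
    (hZ : FieldSmoothNear Z x) (v : TangentSpace (𝓡 (4 * n)) x) :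
    D (Y - Z) x v = D Y x v - D Z x v := by
  rw [sub_eq_add_neg, connection_add D hY hZ.neg, connection_neg D hZ, sub_eq_add_neg]

theorem connection_sum (D : LinearConnection n M) {ι : Type*} {s : Finset ι}
    {Z : ι → ∀ x : M, TangentSpace (𝓡 (4 * n)) x} (hZ : ∀ i ∈ s, FieldSmoothNear (Z i) x)
    (v : TangentSpace (𝓡 (4 * n)) x) :
    D (fun y => ∑ i ∈ s, Z i y) x v = ∑ i ∈ s, D (Z i) x v := by
  classical
  induction s using Finset.induction_on with
  | empty =>
    simp only [Finset.sum_empty]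
    exact congr($(D.isCovariantDerivativeOnUniv.zero (x := x)) v)
  | insert a s ha ih =>
    simp only [Finset.mem_insert, forall_eq_or_imp] at hZ
    simp only [Finset.sum_insert ha]
    rw [← ih hZ.2]
    exact connection_add D hZ.1 (.sum hZ.2) v

theorem frameCoeffAt_frameAt (x : M) (i j : Fin (4 * n)) :
    frameCoeffAt x i x (frameAt x j x) = if j = i then 1 else 0 := by
  obtain ⟨b, hb, hb'⟩ := (eventually_exists_basis_frameAt (n := n) x).self_of_nhds
  rw [← hb, ← hb', b.repr_self, Finsupp.single_apply]

/-- The components of `∇_v W` in a local frame. -/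
theorem frameCoeffAt_connection (D : LinearConnection n M) (hW : FieldSmoothNear W x)
    (i : Fin (4 * n)) (v : TangentSpace (𝓡 (4 * n)) x) :
    frameCoeffAt x i x (D W x v)
      = mvfderiv (𝓡 (4 * n)) (fun y => frameCoeffAt x i y (W y)) x v
        + ∑ j, frameCoeffAt x j x (W x) * frameCoeffAt x i x (D (frameAt x j) x v) := by
  have h1 : ∀ j, FieldSmoothNear
      ((fun y => frameCoeffAt x j y (W y)) • frameAt x j) x := fun j =>
    FieldSmoothNear.smul (hW.frameCoeffAt j) (fieldSmoothNear_frameAt x j)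
  have h2 : D W x v = ∑ j, D ((fun y => frameCoeffAt x j y (W y)) • frameAt x j) x v := by
    rw [← connection_sum D (fun j _ => h1 j), connection_congr D (.sum fun j _ => h1 j)]
    filter_upwards [eventually_eq_sum_frameAt (n := n) x] with y hy
    exact hy (W y)
  rw [h2, map_sum, add_comm]
  simp only [connection_smul D (hW.frameCoeffAt _) (fieldSmoothNear_frameAt x _), map_add, map_smul,
    smul_eq_mul, Finset.sum_add_distrib, frameCoeffAt_frameAt]
  simp

theorem FieldSmoothNear.connection (hD : CovariantDerivative.ContMDiffCovariantDerivative D ∞)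
    (hZ : FieldSmoothNear Z x) (hY : FieldSmoothNear Y x) :
    FieldSmoothNear (fun y => D Z y (Y y)) x := by
  obtain ⟨W, hW, hWZ⟩ := hZ.exists_global
  have h1 : FieldSmoothNear (fun y => D W y (Y y)) x := by
    refine FieldSmoothNear.clm_apply (A := fun y => D W y) (.of_forall fun y => ?_) hY
    exact (hD.contMDiff.contMDiff (σ := W) hW.contMDiffOn).contMDiffAt Filter.univ_mem
  refine h1.congr ?_
  filter_upwards [hZ.eventually, eventually_eventually_nhds.2 hWZ] with y h2 h3
  rw [connection_congr D h2 h3]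

end Connections

/-! ### Curvature on vector fields and its trace. -/

section Curvature

set_option linter.unusedSectionVars false

variable {n : ℕ} {M : Type*} [TopologicalSpace M] [T2Space M]
  [ChartedSpace (EuclideanSpace ℝ (Fin (4 * n))) M] [IsManifold (𝓡 (4 * n)) ∞ M]
  {D : LinearConnection n M}
  {x : M} {X Y Z W : ∀ x : M, TangentSpace (𝓡 (4 * n)) x} {f : M → ℝ}

/-- `R(X, Y)Z = ∇_X ∇_Y Z - ∇_Y ∇_X Z - ∇_{[X, Y]} Z` for vector fields `X, Y, Z`. -/
noncomputable def curvatureField (D : LinearConnection n M)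
    (X Y Z : ∀ x : M, TangentSpace (𝓡 (4 * n)) x) (x : M) : TangentSpace (𝓡 (4 * n)) x :=
  D (fun y => D Z y (Y y)) x (X x) - D (fun y => D Z y (X y)) x (Y x)
    - D Z x (mlieBracket (𝓡 (4 * n)) X Y x)

theorem curvature_eq_curvatureField (D : LinearConnection n M)
    (u v w : TangentSpace (𝓡 (4 * n)) x) :
    curvature D x u v w = curvatureField D (FiberBundle.extend (EuclideanSpace ℝ (Fin (4 * n))) u)
      (FiberBundle.extend (EuclideanSpace ℝ (Fin (4 * n))) v)
      (FiberBundle.extend (EuclideanSpace ℝ (Fin (4 * n))) w) x := by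
  simp [curvature, curvatureField]

section Smooth

variable (hD : CovariantDerivative.ContMDiffCovariantDerivative D ∞)
  (hX : FieldSmoothNear X x) (hY : FieldSmoothNear Y x)

include hD hX hY

theorem curvatureField_congr (hZ : FieldSmoothNear Z x) (h : ∀ᶠ y in 𝓝 x, W y = Z y) :
    curvatureField D X Y W x = curvatureField D X Y Z x := by
  have h1 : ∀ᶠ y in 𝓝 x, D W y = D Z y := by
    filter_upwards [eventually_eventually_nhds.2 h, hZ.eventually] with y h2 h3
    exact connection_congr D h3 h2
  simp only [curvatureField]
  rw [h1.self_of_nhds,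
    connection_congr D (hZ.connection hD hY) (Z := fun y => D W y (Y y))
      (h1.mono fun y hy => by rw [hy]),
    connection_congr D (hZ.connection hD hX) (Z := fun y => D W y (X y))
      (h1.mono fun y hy => by rw [hy])]

theorem curvatureField_add (hZ : FieldSmoothNear Z x) (hW : FieldSmoothNear W x) :
    curvatureField D X Y (Z + W) x = curvatureField D X Y Z x + curvatureField D X Y W x := by
  have key : ∀ {V : ∀ x : M, TangentSpace (𝓡 (4 * n)) x}, FieldSmoothNear V x →
      D (fun y => D (Z + W) y (V y)) x
        = D ((fun y => D Z y (V y)) + fun y => D W y (V y)) x := fun hV => by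
    refine connection_congr D ((hZ.connection hD hV).add (hW.connection hD hV)) ?_
    filter_upwards [hZ.eventually, hW.eventually] with y h1 h2
    exact connection_add D h1 h2 _
  simp only [curvatureField]
  rw [key hX, key hY, connection_add D hZ hW,
    connection_add D (hZ.connection hD hX) (hW.connection hD hX),
    connection_add D (hZ.connection hD hY) (hW.connection hD hY)]
  abel

/-- The terms with one derivative of f cancel by antisymmetry in X and Y; those with two cancel
against the bracket term because [X,Y]f = X(Yf) - Y(Xf). Only this third slot has to be tensorial:
the first two keep fixed extensions. -/
theorem curvatureField_smul (hf : FunctionSmoothNear (n := n) f x) (hZ : FieldSmoothNear Z x) :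
    curvatureField D X Y (f • Z) x = f x • curvatureField D X Y Z x := by
  have key : ∀ {V : ∀ x : M, TangentSpace (𝓡 (4 * n)) x}, FieldSmoothNear V x →
      ∀ v, D (fun y => D (f • Z) y (V y)) x v
        = f x • D (fun y => D Z y (V y)) x v + mvfderiv (𝓡 (4 * n)) f x v • D Z x (V x)
          + (dirDeriv V f x • D Z x v + mvfderiv (𝓡 (4 * n)) (dirDeriv V f) x v • Z x) := by
    intro V hV v
    have h1 := FieldSmoothNear.smul hf (hZ.connection hD hV)
    have h2 := FieldSmoothNear.smul (hf.dirDeriv hV) hZ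
    rw [connection_congr D (h1.add h2), connection_add D h1 h2,
      connection_smul D hf (hZ.connection hD hV), connection_smul D (hf.dirDeriv hV) hZ]
    filter_upwards [hf.eventually, hZ.eventually] with y h3 h4
    exact connection_smul D h3 h4 _
  have h2 := dirDeriv_mlieBracket hX hY hf
  simp only [dirDeriv] at h2
  simp only [curvatureField]
  rw [key hX, key hY, connection_smul D hf hZ, h2]
  simp only [dirDeriv]
  module

theorem curvatureField_sum {ι : Type*} {s : Finset ι}
    {Z : ι → ∀ x : M, TangentSpace (𝓡 (4 * n)) x} (hZ : ∀ i ∈ s, FieldSmoothNear (Z i) x) :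
    curvatureField D X Y (fun y => ∑ i ∈ s, Z i y) x = ∑ i ∈ s, curvatureField D X Y (Z i) x := by
  classical
  induction s using Finset.induction_on with
  | empty =>
    have h0 : FunctionSmoothNear (n := n) (fun _ : M => (0 : ℝ)) x :=
      .of_forall fun y => contMDiffAt_const
    -- The zero field is handled as 0 • X.
    have := curvatureField_smul hD hX hY h0 hX
    simp only [zero_smul] at this
    rw [Finset.sum_empty, ← this]
    congr 1
    ext y
    simp
  | insert a s ha ih =>
    simp only [Finset.mem_insert, forall_eq_or_imp] at hZ
    simp only [Finset.sum_insert ha]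
    rw [← ih hZ.2]
    exact curvatureField_add hD hX hY hZ.1 (.sum hZ.2)

theorem curvatureField_eq_sum_frameAt (hZ : FieldSmoothNear Z x) :
    curvatureField D X Y Z x
      = ∑ i, frameCoeffAt x i x (Z x) • curvatureField D X Y (frameAt x i) x := by
  have h1 : ∀ i, FieldSmoothNear
      ((fun y => frameCoeffAt x i y (Z y)) • frameAt x i) x := fun i =>
    FieldSmoothNear.smul (hZ.frameCoeffAt i) (fieldSmoothNear_frameAt x i)
  rw [← curvatureField_congr hD hX hY hZ (W := fun y => ∑ i,
    ((fun y => frameCoeffAt x i y (Z y)) • frameAt x i) y), curvatureField_sum hD hX hY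
      (fun i _ => h1 i)]
  · exact Finset.sum_congr rfl fun i _ =>
      curvatureField_smul hD hX hY (hZ.frameCoeffAt i) (fieldSmoothNear_frameAt x i)
  · filter_upwards [eventually_eq_sum_frameAt (n := n) x] with y hy
    exact (hy (Z y)).symm

theorem curvatureField_complexStructure {H : HypercomplexStructure n M}
    (hH : PreservesHypercomplex H D) (s : Fin 3) (hZ : FieldSmoothNear Z x) :
    curvatureField D X Y (fun y => H.J s y (Z y)) x = H.J s x (curvatureField D X Y Z x) := by
  have key : ∀ {V : ∀ x : M, TangentSpace (𝓡 (4 * n)) x}, FieldSmoothNear V x → ∀ v,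
      D (fun y => D (fun y => H.J s y (Z y)) y (V y)) x v
        = H.J s x (D (fun y => D Z y (V y)) x v) := by
    intro V hV v
    rw [← hH s _ x (hZ.connection hD hV).mdifferentiableAt v]
    rw [connection_congr D ((hZ.connection hD hV).complexStructure H s)]
    filter_upwards [hZ.eventually] with y hy
    exact hH s _ y hy.mdifferentiableAt _
  simp only [curvatureField]
  rw [key hX, key hY, hH s _ x hZ.mdifferentiableAt, map_sub, map_sub]

/-- Differentiate |Z|² along X and Y in both orders: the cross terms g(∇_X Z, ∇_Y Z) cancel, and
comparison with [X,Y]|Z|² leaves 2g(R(X,Y)Z, Z) = 0. -/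
theorem inner_curvatureField_self {g : TangentMetric n M} (hg : PreservesMetric g D)
    (hZ : FieldSmoothNear Z x) : g.inner x (curvatureField D X Y Z x) (Z x) = 0 := by
  have h1 : ∀ {V : ∀ x : M, TangentSpace (𝓡 (4 * n)) x},
      ∀ᶠ y in 𝓝 x, dirDeriv V (fun z => g.inner z (Z z) (Z z)) y
        = 2 * g.inner y (D Z y (V y)) (Z y) := by
    intro V
    filter_upwards [hZ.eventually] with y hy
    rw [dirDeriv, hg Z Z y hy.mdifferentiableAt hy.mdifferentiableAt, g.symm y (Z y)]
    ring
  have h2 : ∀ {U V : ∀ x : M, TangentSpace (𝓡 (4 * n)) x}, FieldSmoothNear V x →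
      dirDeriv U (dirDeriv V (fun z => g.inner z (Z z) (Z z))) x
        = 2 * (g.inner x (D (fun y => D Z y (V y)) x (U x)) (Z x)
          + g.inner x (D Z x (V x)) (D Z x (U x))) := by
    intro U V hV
    have h3 := FieldSmoothNear.inner g (hZ.connection hD hV) hZ
    have h4 : dirDeriv V (fun z => g.inner z (Z z) (Z z)) =ᶠ[𝓝 x]
        fun y => g.inner y (D Z y (V y)) (Z y) + g.inner y (D Z y (V y)) (Z y) := by
      filter_upwards [h1 (V := V)] with y hy
      rw [hy, two_mul]
    rw [dirDeriv_congr h4, dirDeriv_add h3 h3, dirDeriv,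
      hg _ Z x (hZ.connection hD hV).mdifferentiableAt hZ.mdifferentiableAt]
    ring
  have h5 := dirDeriv_mlieBracket hX hY (FieldSmoothNear.inner g hZ hZ)
  rw [h2 hX, h2 hY, (h1 (V := mlieBracket (𝓡 (4 * n)) X Y)).self_of_nhds,
    g.symm x (D Z x (X x))] at h5
  simp only [curvatureField, map_sub, sub_apply]
  linarith

end Smooth

/-- The trace of the connection form of `D` in the frame `frameAt x`, applied to `X`. -/
noncomputable def connectionTrace (D : LinearConnection n M) (x : M)
    (X : ∀ x : M, TangentSpace (𝓡 (4 * n)) x) (y : M) : ℝ :=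
  ∑ i, frameCoeffAt x i y (D (frameAt x i) y (X y))

theorem functionSmoothNear_connectionTrace
    (hD : CovariantDerivative.ContMDiffCovariantDerivative D ∞) (hX : FieldSmoothNear X x) :
    FunctionSmoothNear (n := n) (connectionTrace D x X) x :=
  FunctionSmoothNear.sum fun i _ =>
    ((fieldSmoothNear_frameAt x i).connection hD hX).frameCoeffAt i

/-- The trace of the curvature is the exterior derivative of the trace of the connection form. -/
theorem sum_frameCoeffAt_curvatureField
    (hD : CovariantDerivative.ContMDiffCovariantDerivative D ∞) (hX : FieldSmoothNear X x)
    (hY : FieldSmoothNear Y x) :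
    ∑ i, frameCoeffAt x i x (curvatureField D X Y (frameAt x i) x)
      = dirDeriv X (connectionTrace D x Y) x - dirDeriv Y (connectionTrace D x X) x
        - connectionTrace D x (mlieBracket (𝓡 (4 * n)) X Y) x := by
  have h1 : ∀ {V : ∀ x : M, TangentSpace (𝓡 (4 * n)) x}, FieldSmoothNear V x → ∀ i,
      FunctionSmoothNear (n := n) (fun y => frameCoeffAt x i y (D (frameAt x i) y (V y))) x :=
    fun hV i => ((fieldSmoothNear_frameAt x i).connection hD hV).frameCoeffAt i
  simp only [curvatureField, map_sub, Finset.sum_sub_distrib,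
    frameCoeffAt_connection D ((fieldSmoothNear_frameAt x _).connection hD hX),
    frameCoeffAt_connection D ((fieldSmoothNear_frameAt x _).connection hD hY),
    Finset.sum_add_distrib]
  have h2 : dirDeriv X (connectionTrace D x Y) x = _ := dirDeriv_sum fun i _ => h1 hY i
  have h3 : dirDeriv Y (connectionTrace D x X) x = _ := dirDeriv_sum fun i _ => h1 hX i
  -- With ω the connection matrix, the curvature is dω + ω∧ω. Swapping the summation indices in one
  -- double sum shows that tr(ω∧ω) = 0.
  rw [h2, h3, Finset.sum_comm (f := fun i j => frameCoeffAt x j x (D (frameAt x i) x (Y x)) * _)]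
  simp only [dirDeriv, connectionTrace]
  simp only [mul_comm]
  ring

end Curvature

/-! ### Quaternionic linear algebra and traces in one tangent space. -/

section PointwiseAlgebra

set_option linter.unusedSectionVars false

variable {n : ℕ} {M : Type*} [TopologicalSpace M]
  [ChartedSpace (EuclideanSpace ℝ (Fin (4 * n))) M] [IsManifold (𝓡 (4 * n)) ∞ M] {x : M}

theorem HypercomplexStructure.exists_anticommute (H : HypercomplexStructure n M) (s : Fin 3) :
    ∃ t, ∀ x v, H.J t x (H.J s x v) = -H.J s x (H.J t x v) := by
  have h10 : ∀ x v, H.J 1 x (H.J 0 x v) = -H.J 0 x (H.J 1 x v) := fun x v => by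
    rw [H.mul_10, H.mul_01]
  fin_cases s
  · exact ⟨1, h10⟩
  · exact ⟨0, fun x v => (neg_eq_iff_eq_neg.2 (h10 x v)).symm⟩
  · refine ⟨0, fun x v => ?_⟩
    simp only [Fin.reduceFinMk, ← H.mul_01, h10]
    rw [map_neg, neg_neg]

theorem orthoFrame_repr (g : TangentMetric n M) (v : TangentSpace (𝓡 (4 * n)) x)
    (a : Fin (4 * n)) : (orthoFrame g x).repr v a = g.inner x v (orthoFrame g x a) := by
  conv_rhs => rw [← (orthoFrame g x).sum_repr v]
  simp [-Module.Basis.sum_repr, orthoFrame_inner]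

theorem sum_inner_orthoFrame_eq_trace (g : TangentMetric n M)
    (A : TangentSpace (𝓡 (4 * n)) x →ₗ[ℝ] TangentSpace (𝓡 (4 * n)) x) :
    ∑ a, g.inner x (A (orthoFrame g x a)) (orthoFrame g x a) = LinearMap.trace ℝ _ A := by
  rw [LinearMap.trace_eq_matrix_trace ℝ (orthoFrame g x), Matrix.trace]
  simp [LinearMap.toMatrix_apply, orthoFrame_repr]

theorem IsHyperhermitian.inner_left {H : HypercomplexStructure n M} {g : TangentMetric n M}
    (hg : IsHyperhermitian H g) (s : Fin 3) (v w : TangentSpace (𝓡 (4 * n)) x) :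
    g.inner x (H.J s x v) w = -g.inner x v (H.J s x w) := by
  rw [← hg s x v (H.J s x w), H.sq, map_neg, neg_neg]

/-- The vectors J_s e_a again form an orthonormal basis, and the metric trace does not depend on the
basis. -/
theorem IsHyperhermitian.sum_bilin {H : HypercomplexStructure n M} {g : TangentMetric n M}
    (hg : IsHyperhermitian H g) (s : Fin 3)
    (B : TangentSpace (𝓡 (4 * n)) x →ₗ[ℝ] TangentSpace (𝓡 (4 * n)) x →ₗ[ℝ] ℝ) :
    ∑ a, B (H.J s x (orthoFrame g x a)) (H.J s x (orthoFrame g x a))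
      = ∑ a, B (orthoFrame g x a) (orthoFrame g x a) := by
  have h1 : ∀ a, B (H.J s x (orthoFrame g x a)) (H.J s x (orthoFrame g x a))
      = ∑ b, ∑ c, g.inner x (H.J s x (orthoFrame g x b)) (orthoFrame g x a)
        * (g.inner x (H.J s x (orthoFrame g x c)) (orthoFrame g x a)
        * B (orthoFrame g x b) (orthoFrame g x c)) := fun a => by
    conv_lhs => rw [← (orthoFrame g x).sum_repr (H.J s x (orthoFrame g x a))]
    simp only [map_sum, LinearMap.sum_apply, map_smul, LinearMap.smul_apply, smul_eq_mul,
      orthoFrame_repr, hg.inner_left s (orthoFrame g x a), Finset.mul_sum]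
    rw [Finset.sum_comm]
    refine Finset.sum_congr rfl fun b _ => Finset.sum_congr rfl fun c _ => ?_
    rw [g.symm x _ (orthoFrame g x a), g.symm x _ (orthoFrame g x a)]
    ring
  have h2 : ∀ b c, ∑ a, g.inner x (H.J s x (orthoFrame g x b)) (orthoFrame g x a)
        * g.inner x (H.J s x (orthoFrame g x c)) (orthoFrame g x a)
      = if b = c then 1 else 0 := fun b c => by
    rw [← orthoFrame_inner g x b c, ← hg s x]
    conv_rhs => rw [← (orthoFrame g x).sum_repr (H.J s x (orthoFrame g x c))]
    simp only [map_sum, map_smul, smul_eq_mul, orthoFrame_repr]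
    exact Finset.sum_congr rfl fun a _ => mul_comm _ _
  simp only [h1]
  rw [Finset.sum_comm]
  refine Finset.sum_congr rfl fun b _ => ?_
  rw [Finset.sum_comm]
  simp only [← mul_assoc, ← Finset.sum_mul, h2]
  simp

/-- A linear endomorphism commuting with the quaternions has no imaginary quaternionic trace. -/
theorem IsHyperhermitian.sum_inner_complexStructure_eq_zero {H : HypercomplexStructure n M}
    {g : TangentMetric n M} (hg : IsHyperhermitian H g) (s : Fin 3)
    (A : TangentSpace (𝓡 (4 * n)) x →ₗ[ℝ] TangentSpace (𝓡 (4 * n)) x)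
    (hA : ∀ t v, A (H.J t x v) = H.J t x (A v)) :
    ∑ a, g.inner x (A (orthoFrame g x a)) (H.J s x (orthoFrame g x a)) = 0 := by
  obtain ⟨t, ht⟩ := H.exists_anticommute s
  let B : TangentSpace (𝓡 (4 * n)) x →ₗ[ℝ] TangentSpace (𝓡 (4 * n)) x →ₗ[ℝ] ℝ :=
    LinearMap.mk₂ ℝ (fun v w => g.inner x (A v) (H.J s x w))
      (by simp) (by simp) (by simp) (by simp)
  have h := hg.sum_bilin t B
  have h2 : ∀ a, B (H.J t x (orthoFrame g x a)) (H.J t x (orthoFrame g x a))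
      = -B (orthoFrame g x a) (orthoFrame g x a) := fun a => by
    simp only [B, LinearMap.mk₂_apply]
    -- Pull J_t out of A, move it past J_s at the cost of a sign, and cancel it from both slots of
    -- the metric.
    rw [hA, ← neg_neg (H.J s x (H.J t x (orthoFrame g x a))), ← ht, map_neg, hg t x]
  simp only [h2, Finset.sum_neg_distrib, B, LinearMap.mk₂_apply] at h
  linarith

end PointwiseAlgebra

/-! ### Symmetries of the curvature tensor and its contractions. -/

section CurvatureTensor

set_option linter.unusedSectionVars false

variable {n : ℕ} {M : Type*} [TopologicalSpace M] [T2Space M]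
  [ChartedSpace (EuclideanSpace ℝ (Fin (4 * n))) M] [IsManifold (𝓡 (4 * n)) ∞ M]
  {D : LinearConnection n M} {H : HypercomplexStructure n M} {g : TangentMetric n M} {x : M}

/-- The curvature endomorphism `w ↦ R(u, v)w`, written out in the frame `frameAt x`. -/
noncomputable def curvatureEnd (D : LinearConnection n M) (x : M)
    (u v : TangentSpace (𝓡 (4 * n)) x) :
    TangentSpace (𝓡 (4 * n)) x →ₗ[ℝ] TangentSpace (𝓡 (4 * n)) x :=
  ∑ i, (frameCoeffAt x i x).smulRight
    (curvatureField D (FiberBundle.extend (EuclideanSpace ℝ (Fin (4 * n))) u)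
      (FiberBundle.extend (EuclideanSpace ℝ (Fin (4 * n))) v) (frameAt x i) x)

section Smooth

variable (hD : CovariantDerivative.ContMDiffCovariantDerivative D ∞)
include hD

theorem curvatureField_extend {Z : ∀ x : M, TangentSpace (𝓡 (4 * n)) x}
    (hZ : FieldSmoothNear Z x) (u v : TangentSpace (𝓡 (4 * n)) x) :
    curvatureField D (FiberBundle.extend (EuclideanSpace ℝ (Fin (4 * n))) u)
      (FiberBundle.extend (EuclideanSpace ℝ (Fin (4 * n))) v) Z x = curvatureEnd D x u v (Z x) := by
  rw [curvatureField_eq_sum_frameAt hD (fieldSmoothNear_extend u) (fieldSmoothNear_extend v) hZ,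
    curvatureEnd]
  simp

theorem curvature_eq_curvatureEnd (u v w : TangentSpace (𝓡 (4 * n)) x) :
    curvature D x u v w = curvatureEnd D x u v w := by
  rw [curvature_eq_curvatureField, curvatureField_extend hD (fieldSmoothNear_extend w),
    FiberBundle.extend_apply_self]

theorem curvatureEnd_complexStructure (hH : PreservesHypercomplex H D) (s : Fin 3)
    (u v w : TangentSpace (𝓡 (4 * n)) x) :
    curvatureEnd D x u v (H.J s x w) = H.J s x (curvatureEnd D x u v w) := by
  have hw := fieldSmoothNear_extend w
  have h := curvatureField_complexStructure hD (fieldSmoothNear_extend u)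
    (fieldSmoothNear_extend v) hH s hw
  rwa [curvatureField_extend hD (hw.complexStructure H s), curvatureField_extend hD hw,
    FiberBundle.extend_apply_self] at h

theorem curvatureEnd_swap (u v w : TangentSpace (𝓡 (4 * n)) x) :
    curvatureEnd D x u v w = -curvatureEnd D x v u w := by
  simp only [← curvature_eq_curvatureEnd hD, curvature]
  rw [mlieBracket_swap_apply, map_neg]
  abel

theorem inner_curvatureEnd_self (hg : PreservesMetric g D) (u v w : TangentSpace (𝓡 (4 * n)) x) :
    g.inner x (curvatureEnd D x u v w) w = 0 := by
  have h := inner_curvatureField_self hD (fieldSmoothNear_extend u) (fieldSmoothNear_extend v)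
    hg (fieldSmoothNear_extend w)
  rwa [curvatureField_extend hD (fieldSmoothNear_extend w), FiberBundle.extend_apply_self] at h

theorem trace_curvatureEnd (u v : TangentSpace (𝓡 (4 * n)) x) :
    LinearMap.trace ℝ _ (curvatureEnd D x u v)
      = mvfderiv (𝓡 (4 * n))
          (connectionTrace D x (FiberBundle.extend (EuclideanSpace ℝ (Fin (4 * n))) v)) x u
        - mvfderiv (𝓡 (4 * n))
          (connectionTrace D x (FiberBundle.extend (EuclideanSpace ℝ (Fin (4 * n))) u)) x v
        - connectionTrace D x (mlieBracket (𝓡 (4 * n))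
          (FiberBundle.extend (EuclideanSpace ℝ (Fin (4 * n))) u)
          (FiberBundle.extend (EuclideanSpace ℝ (Fin (4 * n))) v)) x := by
  have h := sum_frameCoeffAt_curvatureField hD (fieldSmoothNear_extend u)
    (fieldSmoothNear_extend v)
  simp only [dirDeriv, FiberBundle.extend_apply_self] at h
  rw [(eventually_trace_eq_sum_frameAt x).self_of_nhds, ← h]
  exact Finset.sum_congr rfl fun i _ => by
    rw [curvatureField_extend hD (fieldSmoothNear_frameAt x i)]

/-- The first Bianchi identity for torsion-free connections. -/
theorem curvatureEnd_bianchi (hT : ∀ x, D.torsion x = 0) (u v w : TangentSpace (𝓡 (4 * n)) x) :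
    curvatureEnd D x u v w + curvatureEnd D x v w u + curvatureEnd D x w u v = 0 := by
  have h1 : ∀ {y : M} {X Y : ∀ x : M, TangentSpace (𝓡 (4 * n)) x}, FieldSmoothNear X y →
      FieldSmoothNear Y y → D Y y (X y) - D X y (Y y) = mlieBracket (𝓡 (4 * n)) X Y y := by
    intro y X Y hX hY
    have := D.torsion_apply hX.mdifferentiableAt hY.mdifferentiableAt
    rw [hT] at this
    exact (sub_eq_zero.1 this.symm)
  have h2 : ∀ {X Y : ∀ x : M, TangentSpace (𝓡 (4 * n)) x}, FieldSmoothNear X x →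
      FieldSmoothNear Y x → ∀ v, D (fun y => D Y y (X y)) x v - D (fun y => D X y (Y y)) x v
        = D (mlieBracket (𝓡 (4 * n)) X Y) x v := by
    intro X Y hX hY v
    have hXY := hY.connection hD hX
    have hYX := hX.connection hD hY
    rw [← connection_sub D hXY hYX, ← connection_congr D (hX.mlieBracket hY)]
    filter_upwards [hX.eventually, hY.eventually] with y h3 h4
    exact h1 h3 h4
  simp only [← curvature_eq_curvatureEnd hD, curvature_eq_curvatureField]
  have hX := fieldSmoothNear_extend u
  have hY := fieldSmoothNear_extend v
  have hZ := fieldSmoothNear_extend w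
  set X := FiberBundle.extend (EuclideanSpace ℝ (Fin (4 * n))) u
  set Y := FiberBundle.extend (EuclideanSpace ℝ (Fin (4 * n))) v
  set Z := FiberBundle.extend (EuclideanSpace ℝ (Fin (4 * n))) w
  have e1 := h2 hY hZ (X x)
  have e2 := h2 hZ hX (Y x)
  have e3 := h2 hX hY (Z x)
  have f1 := h1 hX (hY.mlieBracket hZ)
  have f2 := h1 hY (hZ.mlieBracket hX)
  have f3 := h1 hZ (hX.mlieBracket hY)
  have j := mlieBracket_jacobi hX hY hZ
  rw [mlieBracket_swap_apply (V := mlieBracket (𝓡 (4 * n)) X Y),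
    mlieBracket_swap (V := X) (W := Z)] at j
  have k : mlieBracket (𝓡 (4 * n)) Y (-mlieBracket (𝓡 (4 * n)) Z X) x
      = -mlieBracket (𝓡 (4 * n)) Y (mlieBracket (𝓡 (4 * n)) Z X) x := by
    have := mlieBracket_const_smul_right (I := 𝓡 (4 * n)) (V := Y) (c := (-1 : ℝ))
      (hZ.mlieBracket hX).mdifferentiableAt
    simpa using this
  rw [k] at j
  simp only [curvatureField]
  -- The second derivatives pair up by vanishing torsion into ∇_X[Y,Z] and its cyclic images.
  -- Vanishing torsion again turns ∇_X[Y,Z] - ∇_{[Y,Z]}X into [X,[Y,Z]], and the cyclic sum of these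
  -- is zero by Jacobi.
  linear_combination (norm := module) e1 + e2 + e3 + f1 + f2 + f3 + j

theorem ricciTensor_eq (u v : TangentSpace (𝓡 (4 * n)) x) : ricciTensor g D x u v
    = ∑ a, g.inner x (curvatureEnd D x (orthoFrame g x a) u v) (orthoFrame g x a) := by
  simp only [ricciTensor, curvatureFour, curvature_eq_curvatureEnd hD]

theorem ricciForm_eq_trace (u v : TangentSpace (𝓡 (4 * n)) x) :
    ricciForm g D x u v = LinearMap.trace ℝ _ (curvatureEnd D x u v) := by
  simp only [ricciForm, curvatureFour, curvature_eq_curvatureEnd hD,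
    sum_inner_orthoFrame_eq_trace]

theorem ricciFormJ_eq (s : Fin 3) (u v : TangentSpace (𝓡 (4 * n)) x) : ricciFormJ H g D s x u v
    = (1 / 2) * ∑ a, g.inner x (curvatureEnd D x u v (orthoFrame g x a))
        (H.J s x (orthoFrame g x a)) := by
  simp only [ricciFormJ, curvatureFour, curvature_eq_curvatureEnd hD]

/-- A metric curvature endomorphism is skew. This is applied to the HKT connection, not to the Obata
connection. -/
theorem ricciForm_eq_zero (hg : PreservesMetric g D) (u v : TangentSpace (𝓡 (4 * n)) x) :
    ricciForm g D x u v = 0 := by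
  simp only [ricciForm, curvatureFour, curvature_eq_curvatureEnd hD,
    inner_curvatureEnd_self hD hg, Finset.sum_const_zero]

theorem ricciFormJ_eq_zero (hg : IsHyperhermitian H g) (hH : PreservesHypercomplex H D)
    (s : Fin 3) (u v : TangentSpace (𝓡 (4 * n)) x) : ricciFormJ H g D s x u v = 0 := by
  rw [ricciFormJ_eq hD, hg.sum_inner_complexStructure_eq_zero s _ fun t w =>
    curvatureEnd_complexStructure hD hH t u v w, mul_zero]

theorem ricciTensor_add (u v w : TangentSpace (𝓡 (4 * n)) x) :
    ricciTensor g D x u (v + w) = ricciTensor g D x u v + ricciTensor g D x u w := by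
  simp [ricciTensor_eq hD, Finset.sum_add_distrib]

theorem ricciTensor_smul (c : ℝ) (u v : TangentSpace (𝓡 (4 * n)) x) :
    ricciTensor g D x u (c • v) = c * ricciTensor g D x u v := by
  simp [ricciTensor_eq hD, Finset.mul_sum]

theorem ricciTensor_neg (u v : TangentSpace (𝓡 (4 * n)) x) :
    ricciTensor g D x u (-v) = -ricciTensor g D x u v := by
  simp [ricciTensor_eq hD]

/-- Bianchi for u, v, e_a, paired with e_a and summed. -/
theorem ricciTensor_sub_swap (hT : ∀ x, D.torsion x = 0) (u v : TangentSpace (𝓡 (4 * n)) x) :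
    ricciTensor g D x u v - ricciTensor g D x v u = -ricciForm g D x u v := by
  simp only [ricciTensor_eq hD, ricciForm, curvatureFour, curvature_eq_curvatureEnd hD]
  rw [← Finset.sum_sub_distrib, ← Finset.sum_neg_distrib]
  refine Finset.sum_congr rfl fun a _ => ?_
  have h := congr(g.inner x $(curvatureEnd_bianchi hD hT u v (orthoFrame g x a))
    (orthoFrame g x a))
  rw [curvatureEnd_swap hD v] at h
  simp only [map_add, map_neg, map_zero, add_apply, neg_apply, zero_apply] at h
  linarith

/-- Bianchi for J_s u, v, e_a, paired with J_s e_a and summed; the curvature commutes with J_s and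
J_s is skew for g. -/
theorem ricciTensor_complexStructure_add (hg : IsHyperhermitian H g)
    (hH : PreservesHypercomplex H D) (hT : ∀ x, D.torsion x = 0) (s : Fin 3)
    (u v : TangentSpace (𝓡 (4 * n)) x) :
    ricciTensor g D x (H.J s x u) (H.J s x v) + ricciTensor g D x v u
      = 2 * ricciFormJ H g D s x (H.J s x u) v := by
  simp only [ricciTensor_eq hD, ricciFormJ_eq hD]
  rw [← Finset.sum_add_distrib, ← mul_assoc, mul_one_div_cancel two_ne_zero, one_mul]
  refine Finset.sum_congr rfl fun a _ => ?_
  have h := congr(g.inner x $(curvatureEnd_bianchi hD hT (H.J s x u) v (orthoFrame g x a))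
    (H.J s x (orthoFrame g x a)))
  rw [curvatureEnd_complexStructure hD hH, curvatureEnd_swap hD v] at h
  simp only [map_add, map_neg, map_zero, add_apply, neg_apply, zero_apply, hg s x] at h
  rw [curvatureEnd_complexStructure hD hH, hg.inner_left]
  linarith

theorem ricciTensor_complexStructure (hg : IsHyperhermitian H g)
    (hH : PreservesHypercomplex H D) (hT : ∀ x, D.torsion x = 0) (s : Fin 3)
    (u v : TangentSpace (𝓡 (4 * n)) x) :
    ricciTensor g D x (H.J s x u) (H.J s x v) = -ricciTensor g D x v u := by
  have h := ricciTensor_complexStructure_add hD hg hH hT s u v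
  rw [ricciFormJ_eq_zero hD hg hH] at h
  linarith

/-- Each J_s swaps the arguments of Ric up to sign. Using J_1 and then J_2 restores order and sign,
whereas their product J_3 must swap with a sign. -/
theorem ricciTensor_skew (hg : IsHyperhermitian H g)
    (hH : PreservesHypercomplex H D) (hT : ∀ x, D.torsion x = 0)
    (u v : TangentSpace (𝓡 (4 * n)) x) :
    ricciTensor g D x u v = -ricciTensor g D x v u := by
  have h := ricciTensor_complexStructure (x := x) hD hg hH hT
  have h2 := h 2 u v
  rw [← H.mul_01, ← H.mul_01, h 0, h 1, neg_neg] at h2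
  exact h2

theorem scalarCurvature_eq_zero (hg : IsHyperhermitian H g)
    (hH : PreservesHypercomplex H D) (hT : ∀ x, D.torsion x = 0) : scalarCurvature g D x = 0 :=
  Finset.sum_eq_zero fun a _ => by
    have := ricciTensor_skew hD hg hH hT (orthoFrame g x a) (orthoFrame g x a)
    linarith

theorem scalarCurvatureJ_eq_zero (hg : IsHyperhermitian H g)
    (hH : PreservesHypercomplex H D) (hT : ∀ x, D.torsion x = 0) (s : Fin 3) :
    scalarCurvatureJ H g D s x = 0 := by
  have hsk := ricciTensor_skew (x := x) hD hg hH hT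
  obtain ⟨t, ht⟩ := H.exists_anticommute s
  let B : TangentSpace (𝓡 (4 * n)) x →ₗ[ℝ] TangentSpace (𝓡 (4 * n)) x →ₗ[ℝ] ℝ :=
    LinearMap.mk₂ ℝ (fun v w => ricciTensor g D x (H.J s x v) w)
      -- Linearity of Ric in its first slot is deduced from linearity in the second by
      -- skew-symmetry.
      (fun u v w => by
        rw [hsk, map_add, ricciTensor_add hD, hsk w, hsk w]
        ring)
      (fun c v w => by
        rw [hsk, map_smul, ricciTensor_smul hD, hsk w, smul_eq_mul]
        ring)
      (fun u v w => ricciTensor_add hD _ _ _) (fun c v w => ricciTensor_smul hD _ _ _)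
  have h := hg.sum_bilin t B
  have h2 : ∀ a, B (H.J t x (orthoFrame g x a)) (H.J t x (orthoFrame g x a))
      = -B (orthoFrame g x a) (orthoFrame g x a) := fun a => by
    have h3 : B (H.J t x (orthoFrame g x a)) (H.J t x (orthoFrame g x a))
      = ricciTensor g D x (H.J s x (H.J t x (orthoFrame g x a))) (H.J t x (orthoFrame g x a)) := rfl
    -- J_t anticommutes with J_s while Ric is J_t-invariant, so replacing e_a by J_t e_a changes the
    -- sign of Ric(J_s e_a, e_a).
    rw [h3, ← neg_neg (H.J s x (H.J t x (orthoFrame g x a))), ← ht, hsk, ricciTensor_neg hD,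
      neg_neg, ricciTensor_complexStructure hD hg hH hT]
    rfl
  simp only [h2, Finset.sum_neg_distrib] at h
  have h3 : scalarCurvatureJ H g D s x = ∑ a, B (orthoFrame g x a) (orthoFrame g x a) := rfl
  linarith

end Smooth

end CurvatureTensor

/-! ### The Lee form as a connection trace. -/

section LeeForm

set_option linter.unusedSectionVars false

variable {n : ℕ} {M : Type*} [TopologicalSpace M]
  [ChartedSpace (EuclideanSpace ℝ (Fin (4 * n))) M] [IsManifold (𝓡 (4 * n)) ∞ M]
  {D D' : LinearConnection n M} {H : HypercomplexStructure n M} {g : TangentMetric n M} {x : M}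

theorem connection_difference_apply (D D' : LinearConnection n M)
    {X : ∀ x : M, TangentSpace (𝓡 (4 * n)) x} (hX : IsDifferentiableFieldAt X x)
    (v : TangentSpace (𝓡 (4 * n)) x) :
    D'.difference D x (X x) v = D' X x v - D X x v :=
  congr($(IsCovariantDerivativeOn.difference_apply D'.isCovariantDerivativeOnUniv
    D.isCovariantDerivativeOnUniv (x := x) (by trivial) hX) v)

/-- The torsion of `D` in terms of its difference to a torsion-free connection. -/
theorem torsion_eq_difference (hT : ∀ x, D'.torsion x = 0) (u v : TangentSpace (𝓡 (4 * n)) x) :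
    D.torsion x u v = D'.difference D x u v - D'.difference D x v u := by
  have hX := (fieldSmoothNear_extend u).mdifferentiableAt
  have hY := (fieldSmoothNear_extend v).mdifferentiableAt
  have h1 := D.torsion_apply hX hY
  have h2 := D'.torsion_apply hX hY
  have h3 := connection_difference_apply D D' hX v
  have h4 := connection_difference_apply D D' hY u
  rw [hT] at h2
  simp only [FiberBundle.extend_apply_self, zero_apply] at h1 h2 h3 h4
  rw [h1, h3, h4]
  linear_combination (norm := module) -h2

theorem difference_complexStructure (hH : PreservesHypercomplex H D)
    (hH' : PreservesHypercomplex H D') (s : Fin 3) (u v : TangentSpace (𝓡 (4 * n)) x) :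
    D'.difference D x (H.J s x u) v = H.J s x (D'.difference D x u v) := by
  have hX := fieldSmoothNear_extend u
  have h1 := connection_difference_apply D D' hX.mdifferentiableAt v
  have h2 := connection_difference_apply D D' (hX.complexStructure H s).mdifferentiableAt v
  rw [hH s _ x hX.mdifferentiableAt, hH' s _ x hX.mdifferentiableAt, ← map_sub, ← h1] at h2
  simpa only [FiberBundle.extend_apply_self] using h2

/-- The endomorphism `u ↦ ∇'_v u - ∇_v u` given by two connections and a tangent vector `v`. -/
noncomputable def differenceEnd (D D' : LinearConnection n M) (x : M)
    (v : TangentSpace (𝓡 (4 * n)) x) :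
    TangentSpace (𝓡 (4 * n)) x →ₗ[ℝ] TangentSpace (𝓡 (4 * n)) x where
  toFun u := D'.difference D x u v
  map_add' := by simp
  map_smul' := by simp

theorem differenceEnd_apply (u v : TangentSpace (𝓡 (4 * n)) x) :
    differenceEnd D D' x v u = D'.difference D x u v :=
  rfl

/-- The Lee form as the trace of the difference of the Obata and the HKT connection. -/
theorem neg_two_mul_leeForm (hD : IsHKT H g D) (hD' : IsObataConnection H D') (t : Fin 3)
    (v : TangentSpace (𝓡 (4 * n)) x) :
    -2 * leeForm H g D t x v = LinearMap.trace ℝ _ (differenceEnd D D' x v) := by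
  -- A_{J_t v} commutes with the quaternions, so its trace against J_t vanishes.
  have h1 := hD.hyperhermitian.sum_inner_complexStructure_eq_zero t
    (differenceEnd D D' x (H.J t x v))
    fun s w => difference_complexStructure hD.preserves hD'.preserves s w (H.J t x v)
  have h2 : ∀ e, g.inner x (D.torsion x v e) e = 0 := fun e => by
    have := hD.skew_torsion x v e e
    simp only [torsionThree] at this
    linarith
  -- Here T(J_t v, e) = A_e(J_t v) - A_{J_t v} e. The first term paired with J_t e is g(A_e v, e),
  -- which equals g(A_v e, e) because T(v, e, e) = 0.
  have h3 : ∀ e, torsionThree g D x (H.J t x v) e (H.J t x e)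
      = g.inner x (D'.difference D x e v) e
        - g.inner x (D'.difference D x e (H.J t x v)) (H.J t x e) := fun e => by
    have h4 := h2 e
    rw [torsion_eq_difference hD'.torsion_eq_zero, map_sub, sub_apply] at h4
    rw [torsionThree, torsion_eq_difference hD'.torsion_eq_zero, map_sub, sub_apply,
      difference_complexStructure hD.preserves hD'.preserves, hD.hyperhermitian t x]
    linarith
  simp only [differenceEnd_apply] at h1
  rw [← sum_inner_orthoFrame_eq_trace g, leeForm]
  simp only [h3, Finset.sum_sub_distrib, h1, differenceEnd_apply]
  ring

theorem connectionTrace_sub_eq_leeForm [T2Space M] (hD : IsHKT H g D)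
    (hD' : IsObataConnection H D') (t : Fin 3) (X : ∀ x : M, TangentSpace (𝓡 (4 * n)) x) (x : M) :
    ∀ᶠ y in 𝓝 x, connectionTrace D' x X y - connectionTrace D x X y
      = -2 * leeForm H g D t y (X y) := by
  have h := Filter.eventually_all.2 fun i => (fieldSmoothNear_frameAt (n := n) x i).eventually
  filter_upwards [eventually_trace_eq_sum_frameAt (n := n) x, h] with y h1 h2
  rw [neg_two_mul_leeForm hD hD', h1, connectionTrace, connectionTrace, ← Finset.sum_sub_distrib]
  refine Finset.sum_congr rfl fun i _ => ?_
  rw [← map_sub, ← connection_difference_apply D D' (h2 i).mdifferentiableAt]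
  rfl

theorem ricciForm_eq_extDerivOneForm_leeForm [T2Space M] (hD : IsHKT H g D)
    (hD' : IsObataConnection H D') (t : Fin 3) (u v : TangentSpace (𝓡 (4 * n)) x) :
    ricciForm g D' x u v = -2 * extDerivOneForm (leeForm H g D t) x u v := by
  have h1 := ricciForm_eq_trace (g := g) hD'.smooth u v
  have h2 := ricciForm_eq_trace (g := g) hD.smooth u v
  rw [ricciForm_eq_zero hD.smooth hD.preserves_metric, trace_curvatureEnd hD.smooth] at h2
  rw [trace_curvatureEnd hD'.smooth] at h1
  have h3 : ∀ {X : ∀ x : M, TangentSpace (𝓡 (4 * n)) x}, FieldSmoothNear X x → ∀ w,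
      mvfderiv (𝓡 (4 * n)) (connectionTrace D' x X) x w
        - mvfderiv (𝓡 (4 * n)) (connectionTrace D x X) x w
      = -2 * mvfderiv (𝓡 (4 * n)) (fun y => leeForm H g D t y (X y)) x w := by
    intro X hX w
    have hs := functionSmoothNear_connectionTrace hD.smooth hX
    have hs' := functionSmoothNear_connectionTrace hD'.smooth hX
    -- The orthonormal bases are chosen point by point, so smoothness of θ(X) is not visible from
    -- its definition; it comes from that of the two connection traces.
    have h4 : (fun y => leeForm H g D t y (X y)) =ᶠ[𝓝 x] fun y =>
        -(1 / 2) * (connectionTrace D' x X y - connectionTrace D x X y) := by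
      filter_upwards [connectionTrace_sub_eq_leeForm hD hD' t X x] with y hy
      rw [hy]
      ring
    have h5 := dirDeriv_congr (X := FiberBundle.extend (EuclideanSpace ℝ (Fin (4 * n))) w) h4
    rw [dirDeriv_const_mul _ (hs'.sub hs), dirDeriv_sub hs' hs] at h5
    simp only [dirDeriv, FiberBundle.extend_apply_self] at h5
    rw [h5]
    ring
  have h4 := h3 (fieldSmoothNear_extend u) v
  have h5 := h3 (fieldSmoothNear_extend v) u
  have h6 := (connectionTrace_sub_eq_leeForm hD hD' t (mlieBracket (𝓡 (4 * n))
    (FiberBundle.extend (EuclideanSpace ℝ (Fin (4 * n))) u)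
    (FiberBundle.extend (EuclideanSpace ℝ (Fin (4 * n))) v)) x).self_of_nhds
  rw [h1, extDerivOneForm]
  linarith

end LeeForm

/-! ### The proposition. -/

theorem mainTheorem3 (n : ℕ) {M : Type*} [TopologicalSpace M] [T2Space M] [SigmaCompactSpace M]
    [ChartedSpace (EuclideanSpace ℝ (Fin (4 * n))) M] [IsManifold (𝓡 (4 * n)) ∞ M]
    (H : HypercomplexStructure n M) (Dob : LinearConnection n M) (hDob : IsObataConnection H Dob) :
    -- the identities on a hypercomplex manifold, with any auxiliary hyperhermitian metric `g`
    (∀ g : TangentMetric n M, IsHyperhermitian H g →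
      ∀ (x : M) (X Y : TangentSpace (𝓡 (4 * n)) x),
        (∀ s, ricciTensor g Dob x (H.J s x X) (H.J s x Y) + ricciTensor g Dob x Y X
          = 2 * ricciFormJ H g Dob s x (H.J s x X) Y) ∧
        ricciTensor g Dob x X Y - ricciTensor g Dob x Y X = -ricciForm g Dob x X Y) ∧
    -- the HKT case, with the Lee form computed from any of the three complex structures `J_t`
    (∀ (g : TangentMetric n M) (D : LinearConnection n M), IsHKT H g D → ∀ t : Fin 3,
      -- a) `dθ` is of type (1,1)
      (∀ s (x : M) (X Y : TangentSpace (𝓡 (4 * n)) x),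
        extDerivOneForm (leeForm H g D t) x (H.J s x X) (H.J s x Y)
          = extDerivOneForm (leeForm H g D t) x X Y) ∧
      -- b) the Ricci tensor and the Ricci-type forms of the Obata connection
      (∀ (x : M) (X Y : TangentSpace (𝓡 (4 * n)) x),
        ricciTensor g Dob x X Y = -ricciTensor g Dob x Y X ∧
        ricciTensor g Dob x X Y = extDerivOneForm (leeForm H g D t) x X Y ∧
        ricciForm g Dob x X Y = -2 * extDerivOneForm (leeForm H g D t) x X Y ∧
        (∀ s, ricciFormJ H g Dob s x X Y = 0) ∧
        (∀ s, ricciTensor g Dob x (H.J s x X) (H.J s x Y) = ricciTensor g Dob x X Y)) ∧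
      -- c) the scalar curvatures of the Obata connection vanish
      (∀ x : M, scalarCurvature g Dob x = 0 ∧ ∀ s, scalarCurvatureJ H g Dob s x = 0)) := by
  have hS := hDob.smooth
  have hJ := hDob.preserves
  have hT := hDob.torsion_eq_zero
  refine ⟨fun g hg x X Y => ⟨fun s => ricciTensor_complexStructure_add hS hg hJ hT s X Y,
    ricciTensor_sub_swap hS hT X Y⟩, fun g D hD t => ?_⟩
  have hg := hD.hyperhermitian
  have hric : ∀ (x : M) (X Y : TangentSpace (𝓡 (4 * n)) x),
      ricciTensor g Dob x X Y = extDerivOneForm (leeForm H g D t) x X Y := fun x X Y => by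
    -- Skewness makes the left side 2 Ric(X,Y), while -ρ = 2dθ.
    have h1 := ricciTensor_sub_swap (g := g) hS hT X Y
    rw [ricciForm_eq_extDerivOneForm_leeForm hD hDob t] at h1
    have h2 := ricciTensor_skew hS hg hJ hT X Y
    linarith
  have hinv : ∀ s (x : M) (X Y : TangentSpace (𝓡 (4 * n)) x),
      ricciTensor g Dob x (H.J s x X) (H.J s x Y) = ricciTensor g Dob x X Y := fun s x X Y => by
    rw [ricciTensor_complexStructure hS hg hJ hT, ← ricciTensor_skew hS hg hJ hT]
  exact ⟨fun s x X Y => by rw [← hric, ← hric, hinv],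
    fun x X Y => ⟨ricciTensor_skew hS hg hJ hT X Y, hric x X Y,
      ricciForm_eq_extDerivOneForm_leeForm hD hDob t X Y,
      fun s => ricciFormJ_eq_zero hS hg hJ s X Y, fun s => hinv s x X Y⟩,
    fun x => ⟨scalarCurvature_eq_zero hS hg hJ hT,
      fun s => scalarCurvatureJ_eq_zero hS hg hJ hT s⟩⟩
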